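/- Let $D$ be the open unit disc in $\mathbb C$, $T$ the unit circle with normalized Haar (arc length) measure $\sigma$, and give $T^2$ the product measure $\sigma\times\sigma$. The Hardy space $H^2(D^2)$ is the closure of the polynomials in $L^2(T^2)$, $P$ is the orthogonal projection of $L^2(T^2)$ onto it, and for $f\in L^\infty(T^2)$ the Toeplitz operator $T_f$ on $H^2(D^2)$ is $T_fh=P(fh)$. For $f\in L^\infty(T^2)$ denote its harmonic extension again by $f$: on $D\times T$ it is $$f(z_1,z_2)=\int_T f(w,z_2)\,\frac{1-|z_1|^2}{|1-\bar z_1 w|^2}\,d\sigma(w)\qquad(z_1\in D,\ z_2\in T),$$ and symmetrically on $T\times D$, where the Poisson integral is taken in the second variable. **Theorem 2.** Let $f,g\in L^\infty(T^2)$ and suppose that $T_fT_g-T_{fg}$ is compact on $H^2(D^2)$. Then: (1) for almost every $z_2\in T$, the functions $f(\cdot,z_2)$ and $g(\cdot,z_2)$ are (real) differentiable on $D$ and, for all $z_1\in D$, $$\frac{\partial f}{\partial z_1}(z_1,z_2)\,\frac{\partial g}{\partial\bar z_1}(z_1,z_2)=0;$$ (2) for almost every $z_1\in T$, the functions $f(z_1,\cdot)$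 and $g(z_1,\cdot)$ are (real) differentiable on $D$ and, for all $z_2\in D$, $$\frac{\partial f}{\partial z_2}(z_1,z_2)\,\frac{\partial g}{\partial\bar z_2}(z_1,z_2)=0.$$ -/

import Mathlib

open MeasureTheory
open scoped ENNReal ComplexConjugate

noncomputable section

namespace Bidisc

/-- The Borel structure on the unit circle `T`. -/
instance instMeasurableSpaceCircle : MeasurableSpace Circle := borel Circle

instance instBorelSpaceCircle : BorelSpace Circle := ⟨rfl⟩

/-- The normalized Haar measure (normalized arc length) on `T`: the image of the normalized
Haar measure of `ℝ / ℤ` under the isomorphism `t ↦ exp (2 π i t)`. -/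
def circleMeasure : Measure Circle :=
  Measure.map (AddCircle.toCircle (T := (1 : ℝ))) AddCircle.haarAddCircle

instance instIsProbabilityMeasureCircle : IsProbabilityMeasure circleMeasure :=
  Measure.isProbabilityMeasure_map AddCircle.continuous_toCircle.measurable.aemeasurable

/-- The normalized Haar measure on the torus `T²`. -/
def torusMeasure : Measure (Circle × Circle) := circleMeasure.prod circleMeasure

instance instIsProbabilityMeasureTorus : IsProbabilityMeasure torusMeasure := by
  unfold torusMeasure; infer_instance

/-- The monomial `w₁ ^ m * w₂ ^ n` as a continuous function on `T²`. -/
def monomial (m n : ℕ) : C(Circle × Circle, ℂ) where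
  toFun w := (w.1 : ℂ) ^ m * (w.2 : ℂ) ^ n
  continuous_toFun := by fun_prop

/-- The Hardy space `H²(D²)`: the closure of the polynomials in `L²(T²)`. -/
def hardySpace : Submodule ℂ (Lp ℂ 2 torusMeasure) :=
  (Submodule.span ℂ (Set.range fun p : ℕ × ℕ ↦
    ContinuousMap.toLp 2 torusMeasure ℂ (monomial p.1 p.2))).topologicalClosure

instance instCompleteSpaceHardySpace : CompleteSpace hardySpace :=
  (Submodule.isClosed_topologicalClosure _).completeSpace_coe

/-- Multiplication by a bounded function `f` on `L²(T²)`. -/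
def mulOp {f : Circle × Circle → ℂ} (hf : MemLp f ∞ torusMeasure) :
    Lp ℂ 2 torusMeasure →L[ℂ] Lp ℂ 2 torusMeasure :=
  (ContinuousLinearMap.mul ℂ ℂ).holderL torusMeasure ∞ 2 2 (hf.toLp f)

/-- The Toeplitz operator `T_f h = P (f h)` on `H²(D²)`, where `P` is the orthogonal projection
of `L²(T²)` onto `H²(D²)`. -/
def toeplitz {f : Circle × Circle → ℂ} (hf : MemLp f ∞ torusMeasure) :
    hardySpace →L[ℂ] hardySpace :=
  hardySpace.orthogonalProjectionOnto ∘L mulOp hf ∘L hardySpace.subtypeL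

/-- The Poisson integral at `z ∈ D` of a function `φ` on `T`. For a function `f` on `T²` and
`w ∈ T`, the (bi)harmonic extension of `f` to `D × T` is
`(z, w) ↦ poissonExt (fun u ↦ f (u, w)) z`, and similarly for `T × D`. -/
def poissonExt (φ : Circle → ℂ) (z : ℂ) : ℂ :=
  ∫ w : Circle, φ w * (((1 - ‖z‖ ^ 2) / ‖1 - conj z * (w : ℂ)‖ ^ 2 : ℝ) : ℂ) ∂circleMeasure

/-- The Wirtinger derivative `∂F/∂z = (∂F/∂x - i ∂F/∂y) / 2`. -/
def dz (F : ℂ → ℂ) (z : ℂ) : ℂ :=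
  (fderiv ℝ F z 1 - Complex.I * fderiv ℝ F z Complex.I) / 2

/-- The Wirtinger derivative `∂F/∂z̄ = (∂F/∂x + i ∂F/∂y) / 2`. -/
def dzbar (F : ℂ → ℂ) (z : ℂ) : ℂ :=
  (fderiv ℝ F z 1 + Complex.I * fderiv ℝ F z Complex.I) / 2

end Bidisc

end

/-!
The operator `T_f T_g - T_{fg}` equals `-P f (1 - P) g`, and translating it far out in the second
variable replaces `P` by the projection onto the functions analytic in the first variable only. The
translates of a compact operator tend weakly to zero, so almost every pair of slices `f(·, z₂)`,
`g(·, z₂)` satisfies the one-variable identity `T_φ T_ψ = T_{φψ}`, which forces `φ̂(j) ψ̂(-k) = 0`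
for all `j, k ≥ 1`. Everything is carried out here on matrix entries.

In the monomial basis of `H²(D²)` the operator `T_f T_g - T_{fg}` has the entries
`∑_r f̂(q - r) ĝ(r - p) - (fg)^(q - p)`, the sum being over `r ∈ ℕ²`; by compactness they tend to
zero along sequences of distinct indices `q` (`vanishingEntries_of_isCompactOperator`). Increasing
both `q` and `p` by one in one of the variables adds to the sum just the terms of one further row of
indices `r`. When `q` and `p` move to infinity in the other variable, this row becomes the full
Parseval sum of a Fourier coefficient of `F_j G_{-k}`, where `F_j` and `G_{-k}` are the partial
Fourier coefficients of `f` and `g`. Hence `F_j G_{-k} = 0` almost everywhere for all `j, k ≥ 1`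
(`VanishingEntries.ae_partialCoeff_mul_eq_zero`).

The Poisson integral of `φ` is `∑_{n ≥ 0} φ̂(n) zⁿ + ∑_{n ≥ 1} φ̂(-n) z̄ⁿ`, so its derivatives
`∂/∂z` and `∂/∂z̄` only involve the coefficients of positive and of negative index, respectively. If
the products `φ̂(j) ψ̂(-k)` all vanish, one of the two families is identically zero, and so is the
product of the derivatives (`dz_mul_dzbar_poissonExt_eq_zero`).

The vanishing of the matrix entries is invariant under exchanging the two variables, so the
argument is given only for slices in the second variable.
-/

open Filter Topology

namespace Bidisc

/-! ### Fourier coefficients on the circle -/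

/-- The `n`-th Fourier coefficient of a function on `T`. -/
noncomputable def circleCoeff (φ : Circle → ℂ) (n : ℤ) : ℂ :=
  ∫ u : Circle, φ u * (u : ℂ) ^ (-n) ∂circleMeasure

theorem measurePreserving_toCircle :
    MeasurePreserving (AddCircle.toCircle (T := (1 : ℝ))) AddCircle.haarAddCircle circleMeasure :=
  ⟨AddCircle.continuous_toCircle.measurable, rfl⟩

theorem measurableEmbedding_toCircle :
    MeasurableEmbedding (AddCircle.toCircle (T := (1 : ℝ))) := by
  have h : (AddCircle.toCircle (T := (1 : ℝ))) = AddCircle.homeomorphCircle one_ne_zero := by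
    ext x; rw [AddCircle.homeomorphCircle_apply]
  rw [h]
  exact (AddCircle.homeomorphCircle one_ne_zero).measurableEmbedding

theorem integral_circleMeasure (φ : Circle → ℂ) :
    ∫ u, φ u ∂circleMeasure =
      ∫ t, φ (AddCircle.toCircle t) ∂(AddCircle.haarAddCircle (T := (1 : ℝ))) :=
  measurableEmbedding_toCircle.integral_map φ

theorem toCircle_zpow (n : ℤ) (t : AddCircle (1 : ℝ)) :
    ((AddCircle.toCircle t : Circle) : ℂ) ^ n = fourier n t := by
  rw [fourier_apply, AddCircle.toCircle_zsmul, Circle.coe_zpow]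

theorem circleCoeff_eq_fourierCoeff (φ : Circle → ℂ) (n : ℤ) :
    circleCoeff φ n = fourierCoeff (fun t : AddCircle (1 : ℝ) ↦ φ (AddCircle.toCircle t)) n := by
  simp only [circleCoeff, fourierCoeff, integral_circleMeasure, toCircle_zpow, smul_eq_mul,
    mul_comm]

theorem integral_circle_zpow (n : ℤ) :
    ∫ u : Circle, (u : ℂ) ^ n ∂circleMeasure = if n = 0 then 1 else 0 := by
  rw [integral_circleMeasure]
  simp only [toCircle_zpow]
  have h := orthonormal_iff_ite.mp (orthonormal_fourier (T := (1 : ℝ))) 0 n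
  rw [ContinuousMap.inner_toLp] at h
  simpa [eq_comm] using h

theorem norm_circle_zpow (u : Circle) (n : ℤ) : ‖(u : ℂ) ^ n‖ = 1 := by
  rw [norm_zpow, Circle.norm_coe, one_zpow]

theorem continuous_circle_zpow (n : ℤ) : Continuous fun u : Circle ↦ (u : ℂ) ^ n := by
  simp only [← Circle.coe_zpow]
  exact continuous_subtype_val.comp (continuous_zpow n)

theorem conj_circle_zpow (u : Circle) (n : ℤ) : conj ((u : ℂ) ^ n) = (u : ℂ) ^ (-n) := by
  rw [← Circle.coe_zpow, ← Circle.coe_inv_eq_conj, ← zpow_neg, Circle.coe_zpow]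

/-- Parseval's identity in convolution form: the Fourier coefficients of a product of two square
integrable functions are the convolution of their Fourier coefficients. -/
theorem hasSum_circleCoeff_mul {φ ψ : Circle → ℂ} (hφ : MemLp φ 2 circleMeasure)
    (hψ : MemLp ψ 2 circleMeasure) (s t : ℤ) :
    HasSum (fun b ↦ circleCoeff φ (t - b) * circleCoeff ψ (b - s))
      (circleCoeff (fun u ↦ φ u * ψ u) (t - s)) := by
  have hφ' : MemLp (fun x ↦ φ (AddCircle.toCircle x)) 2 (AddCircle.haarAddCircle (T := (1 : ℝ))) :=
    hφ.comp_measurePreserving measurePreserving_toCircle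
  have hψ' : MemLp (fun x ↦ ψ (AddCircle.toCircle x)) 2 (AddCircle.haarAddCircle (T := (1 : ℝ))) :=
    hψ.comp_measurePreserving measurePreserving_toCircle
  have key : ∀ n : ℤ, MemLp (fourier n : AddCircle (1 : ℝ) → ℂ) ∞ AddCircle.haarAddCircle := by
    intro n
    exact memLp_top_of_bound (fourier n).continuous.aestronglyMeasurable 1 <| .of_forall fun x ↦ by
      rw [fourier_apply, Circle.norm_coe]
  have hx : MemLp (fun x ↦ fourier t x * conj (φ (AddCircle.toCircle x))) 2
      (AddCircle.haarAddCircle (T := (1 : ℝ))) := MemLp.mul' hφ'.star (key t)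
  have hy : MemLp (fun x ↦ fourier s x * ψ (AddCircle.toCircle x)) 2
      (AddCircle.haarAddCircle (T := (1 : ℝ))) := MemLp.mul' hψ' (key s)
  have h := (fourierBasis (T := (1 : ℝ))).hasSum_inner_mul_inner (hx.toLp _) (hy.toLp _)
  convert! h using 1
  · ext b
    congr 1
    · rw [L2.inner_def, circleCoeff_eq_fourierCoeff, fourierCoeff, coe_fourierBasis]
      apply integral_congr_ae
      filter_upwards [hx.coeFn_toLp, coeFn_fourierLp (T := (1 : ℝ)) 2 b] with x h1 h2
      simp only [h1, h2, RCLike.inner_apply, map_mul, smul_eq_mul, ← fourier_neg,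
        Complex.conj_conj]
      rw [show -(t - b) = b + -t by ring, fourier_add]
      ring
    · rw [L2.inner_def, circleCoeff_eq_fourierCoeff, fourierCoeff, coe_fourierBasis]
      apply integral_congr_ae
      filter_upwards [hy.coeFn_toLp, coeFn_fourierLp (T := (1 : ℝ)) 2 b] with x h1 h2
      simp only [h1, h2, RCLike.inner_apply, smul_eq_mul, ← fourier_neg]
      rw [show -(b - s) = s + -b by ring, fourier_add]
      ring
  · rw [L2.inner_def, circleCoeff_eq_fourierCoeff, fourierCoeff]
    apply integral_congr_ae
    filter_upwards [hx.coeFn_toLp, hy.coeFn_toLp] with x h1 h2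
    simp only [h1, h2, RCLike.inner_apply, map_mul, smul_eq_mul,
      ← fourier_neg, Complex.conj_conj]
    rw [show -(t - s) = s + -t by ring, fourier_add]
    ring

theorem ae_eq_zero_of_circleCoeff_eq_zero {φ : Circle → ℂ} (hφ : MemLp φ 2 circleMeasure)
    (h : ∀ n, circleCoeff φ n = 0) : φ =ᵐ[circleMeasure] 0 := by
  have hφ' : MemLp (fun x ↦ φ (AddCircle.toCircle x)) 2 (AddCircle.haarAddCircle (T := (1 : ℝ))) :=
    hφ.comp_measurePreserving measurePreserving_toCircle
  have h0 : hφ'.toLp _ = 0 := by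
    apply (fourierBasis (T := (1 : ℝ))).repr.injective
    ext n
    rw [fourierBasis_repr, fourierCoeff_congr_ae hφ'.coeFn_toLp]
    simpa [circleCoeff_eq_fourierCoeff] using h n
  have h1 : (fun x ↦ φ (AddCircle.toCircle x)) =ᵐ[AddCircle.haarAddCircle (T := (1 : ℝ))] 0 := by
    have := hφ'.coeFn_toLp
    rw [h0] at this
    exact this.symm.trans (Lp.coeFn_zero _ _ _)
  exact measurableEmbedding_toCircle.ae_map_iff.mpr h1

/-! ### The monomial basis of the Hardy space and the matrix of a Toeplitz operator -/

/-- The Fourier coefficient of index `p` of a function on `T²`. -/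
noncomputable def torusCoeff (f : Circle × Circle → ℂ) (p : ℤ × ℤ) : ℂ :=
  ∫ w : Circle × Circle, f w * ((w.1 : ℂ) ^ (-p.1) * (w.2 : ℂ) ^ (-p.2)) ∂torusMeasure

/-- The monomial of exponent `p` as an element of the Hardy space. -/
noncomputable def hardyMonomial (p : ℕ × ℕ) : hardySpace :=
  ⟨ContinuousMap.toLp 2 torusMeasure ℂ (monomial p.1 p.2),
    Submodule.le_topologicalClosure _ (Submodule.subset_span ⟨p, rfl⟩)⟩

theorem integral_torus_zpow (m n : ℤ) :
    ∫ w : Circle × Circle, (w.1 : ℂ) ^ m * (w.2 : ℂ) ^ n ∂torusMeasure =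
      if m = 0 ∧ n = 0 then 1 else 0 := by
  rw [torusMeasure, integral_prod_mul (fun u : Circle ↦ (u : ℂ) ^ m) fun u : Circle ↦ (u : ℂ) ^ n,
    integral_circle_zpow, integral_circle_zpow]
  by_cases hm : m = 0 <;> by_cases hn : n = 0 <;> simp [hm, hn]

theorem conj_monomial_mul (p q : ℕ × ℕ) (w : Circle × Circle) :
    conj (monomial p.1 p.2 w) * monomial q.1 q.2 w =
      (w.1 : ℂ) ^ ((q.1 : ℤ) - p.1) * (w.2 : ℂ) ^ ((q.2 : ℤ) - p.2) := by
  have h1 : (w.1 : ℂ) ≠ 0 := Circle.coe_ne_zero _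
  have h2 : (w.2 : ℂ) ≠ 0 := Circle.coe_ne_zero _
  simp only [monomial, ContinuousMap.coe_mk, map_mul]
  rw [← zpow_natCast (w.1 : ℂ) p.1, ← zpow_natCast (w.2 : ℂ) p.2, conj_circle_zpow,
    conj_circle_zpow, sub_eq_neg_add, sub_eq_neg_add, zpow_add₀ h1, zpow_add₀ h2, zpow_natCast,
    zpow_natCast]
  ring

theorem orthonormal_hardyMonomial : Orthonormal ℂ hardyMonomial := by
  rw [orthonormal_iff_ite]
  intro p q
  rw [Submodule.coe_inner, hardyMonomial, hardyMonomial, ContinuousMap.inner_toLp]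
  have h : ∀ w, monomial q.1 q.2 w * conj (monomial p.1 p.2 w) =
      (w.1 : ℂ) ^ ((q.1 : ℤ) - p.1) * (w.2 : ℂ) ^ ((q.2 : ℤ) - p.2) := fun w ↦ by
    rw [mul_comm, conj_monomial_mul]
  simp only [h, integral_torus_zpow]
  congr 1
  rw [Prod.ext_iff, eq_iff_iff]
  omega

theorem dense_span_hardyMonomial :
    ⊤ ≤ (Submodule.span ℂ (Set.range hardyMonomial)).topologicalClosure := by
  rintro ⟨x, hx⟩ -
  rw [← SetLike.mem_coe, Submodule.topologicalClosure_coe, closure_subtype]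
  have h : (Subtype.val '' (Submodule.span ℂ (Set.range hardyMonomial) : Set hardySpace)) =
      ((Submodule.span ℂ (Set.range fun p : ℕ × ℕ ↦
        ContinuousMap.toLp 2 torusMeasure ℂ (monomial p.1 p.2)) : Submodule ℂ _) : Set _) := by
    rw [← Submodule.coe_subtype hardySpace, ← Submodule.map_coe, Submodule.map_span,
      ← Set.range_comp]
    rfl
  rw [h]
  exact hx

/-- The monomials as a Hilbert basis of the Hardy space. -/
noncomputable def hardyBasis : HilbertBasis (ℕ × ℕ) ℂ hardySpace :=
  HilbertBasis.mk orthonormal_hardyMonomial dense_span_hardyMonomial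

theorem coe_hardyBasis : ⇑hardyBasis = hardyMonomial :=
  HilbertBasis.coe_mk _ _

/-- The embedding of the index set of the Hardy space into that of all Fourier coefficients. -/
def natPair (p : ℕ × ℕ) : ℤ × ℤ := (p.1, p.2)

/-- A Toeplitz operator has the matrix `(f̂ (q - p))_{q, p}` in the monomial basis. -/
theorem inner_toeplitz_hardyMonomial {f : Circle × Circle → ℂ} (hf : MemLp f ∞ torusMeasure)
    (q p : ℕ × ℕ) :
    inner ℂ (hardyMonomial q) (toeplitz hf (hardyMonomial p)) =
      torusCoeff f (natPair q - natPair p) := by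
  rw [toeplitz, ContinuousLinearMap.comp_apply,
    Submodule.inner_orthogonalProjectionOnto_eq_of_mem_left, L2.inner_def, torusCoeff]
  apply integral_congr_ae
  filter_upwards [ContinuousMap.coeFn_toLp (p := 2) (𝕜 := ℂ) torusMeasure (monomial q.1 q.2),
    ContinuousMap.coeFn_toLp (p := 2) (𝕜 := ℂ) torusMeasure (monomial p.1 p.2), hf.coeFn_toLp,
    (ContinuousLinearMap.mul ℂ ℂ).coeFn_holder (r := 2) (hf.toLp f)
      (ContinuousMap.toLp 2 torusMeasure ℂ (monomial p.1 p.2))] with w h1 h2 h3 h4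
  have h5 : (mulOp hf (ContinuousMap.toLp 2 torusMeasure ℂ (monomial p.1 p.2))) w =
      f w * monomial p.1 p.2 w := by
    rw [← h2, ← h3]
    exact h4
  simp only [RCLike.inner_apply, ContinuousLinearMap.comp_apply, Submodule.subtypeL_apply,
    hardyMonomial, h1, h5]
  rw [mul_assoc, mul_comm (monomial p.1 p.2 w), conj_monomial_mul]
  simp [natPair]

/-- The matrix of a product of Toeplitz operators is the product of their matrices. -/
theorem hasSum_inner_toeplitz_comp {f g : Circle × Circle → ℂ} (hf : MemLp f ∞ torusMeasure)
    (hg : MemLp g ∞ torusMeasure) (q p : ℕ × ℕ) :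
    HasSum (fun r ↦ torusCoeff f (natPair q - natPair r) * torusCoeff g (natPair r - natPair p))
      (inner ℂ (hardyMonomial q) ((toeplitz hf ∘L toeplitz hg) (hardyMonomial p))) := by
  have h := (hardyBasis.hasSum_repr (toeplitz hg (hardyMonomial p))).mapL
    (innerSL ℂ (hardyMonomial q) ∘L toeplitz hf)
  convert! h using 1
  ext r
  rw [map_smul, hardyBasis.repr_apply_apply, coe_hardyBasis, ContinuousLinearMap.comp_apply,
    innerSL_apply_apply, inner_toeplitz_hardyMonomial, inner_toeplitz_hardyMonomial, smul_eq_mul,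
    mul_comm]

/-- The matrix entries of a compact operator tend to zero along two orthonormal sequences. Only
the sequence in the first slot needs to be orthonormal, the other one bounded. -/
theorem tendsto_inner_of_isCompactOperator {H : Type*} [NormedAddCommGroup H]
    [InnerProductSpace ℂ H] {K : H →L[ℂ] H} (hK : IsCompactOperator K) {x y : ℕ → H}
    (hx : ∀ n, ‖x n‖ ≤ 1) (hy : Orthonormal ℂ y) :
    Tendsto (fun n ↦ inner ℂ (y n) (K (x n))) atTop (𝓝 0) := by
  obtain ⟨S, hS, hKS⟩ := hK.image_closedBall_subset_compact (f := (K : H →ₗ[ℂ] H)) 1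
  refine tendsto_of_subseq_tendsto fun ns hns ↦ ?_
  obtain ⟨v, -, φ, hφ, hv⟩ := hS.tendsto_subseq (x := fun n ↦ K (x (ns n))) fun n ↦
    hKS ⟨x (ns n), by simpa using hx (ns n), rfl⟩
  refine ⟨φ, ?_⟩
  -- Bessel's inequality disposes of the limit `v`, the remainder is small in norm.
  have h1 : Tendsto (fun n ↦ inner ℂ (y n) v) atTop (𝓝 0) := by
    have h := (hy.inner_products_summable (x := v)).tendsto_atTop_zero
    rw [tendsto_zero_iff_norm_tendsto_zero]
    simpa using h.sqrt
  have h2 : Tendsto (fun n ↦ inner ℂ (y (ns (φ n))) (K (x (ns (φ n))) - v)) atTop (𝓝 0) := by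
    refine squeeze_zero_norm (fun n ↦ ?_) (tendsto_iff_norm_sub_tendsto_zero.mp hv)
    have := norm_inner_le_norm (𝕜 := ℂ) (y (ns (φ n))) (K (x (ns (φ n))) - v)
    rwa [hy.1, one_mul] at this
  have h3 := h2.add (h1.comp (hns.comp hφ.tendsto_atTop))
  simpa [inner_sub_right] using h3

/-- The matrix entries of `T_f T_g - T_{fg}`, written with Fourier coefficients, tend to zero along
sequences of distinct indices. This form of the compactness of `T_f T_g - T_{fg}` is visibly
symmetric in the two variables of `T²`. -/
def VanishingEntries (f g : Circle × Circle → ℂ) : Prop :=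
  ∀ p q : ℕ → ℕ × ℕ, Function.Injective q →
    (∀ n, Summable fun r ↦
      torusCoeff f (natPair (q n) - natPair r) * torusCoeff g (natPair r - natPair (p n))) ∧
    Tendsto (fun n ↦ (∑' r, torusCoeff f (natPair (q n) - natPair r) *
        torusCoeff g (natPair r - natPair (p n))) -
      torusCoeff (fun w ↦ f w * g w) (natPair (q n) - natPair (p n))) atTop (𝓝 0)

theorem vanishingEntries_of_isCompactOperator {f g : Circle × Circle → ℂ}
    (hf : MemLp f ∞ torusMeasure) (hg : MemLp g ∞ torusMeasure)
    (h : IsCompactOperator (toeplitz hf ∘L toeplitz hg -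
      toeplitz (f := fun w ↦ f w * g w) (hg.mul' hf))) : VanishingEntries f g := by
  intro p q hq
  refine ⟨fun n ↦ (hasSum_inner_toeplitz_comp hf hg (q n) (p n)).summable, ?_⟩
  have := tendsto_inner_of_isCompactOperator (x := fun n ↦ hardyMonomial (p n)) h
    (fun n ↦ (orthonormal_hardyMonomial.1 (p n)).le) (orthonormal_hardyMonomial.comp q hq)
  refine this.congr fun n ↦ ?_
  rw [(hasSum_inner_toeplitz_comp hf hg (q n) (p n)).tsum_eq, ← inner_toeplitz_hardyMonomial
    (f := fun w ↦ f w * g w) (hg.mul' hf)]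
  exact inner_sub_right _ _ _

theorem torusCoeff_swap (f : Circle × Circle → ℂ) (p : ℤ × ℤ) :
    torusCoeff (fun w ↦ f w.swap) p = torusCoeff f p.swap := by
  have h := integral_prod_swap (μ := circleMeasure) (ν := circleMeasure)
    (fun w : Circle × Circle ↦ f w * ((w.1 : ℂ) ^ (-p.2) * (w.2 : ℂ) ^ (-p.1)))
  simp only [torusCoeff, torusMeasure, Prod.fst_swap, Prod.snd_swap] at h ⊢
  rw [← h]
  simp only [mul_comm]

theorem VanishingEntries.swap {f g : Circle × Circle → ℂ} (h : VanishingEntries f g) :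
    VanishingEntries (fun w ↦ f w.swap) (fun w ↦ g w.swap) := by
  intro p q hq
  obtain ⟨h1, h2⟩ := h (fun n ↦ (p n).swap) (fun n ↦ (q n).swap) (Prod.swap_injective.comp hq)
  have key : ∀ n, (fun r ↦ torusCoeff (fun w ↦ f w.swap) (natPair (q n) - natPair r) *
      torusCoeff (fun w ↦ g w.swap) (natPair r - natPair (p n))) =
      (fun r ↦ torusCoeff f (natPair (q n).swap - natPair r) *
        torusCoeff g (natPair r - natPair (p n).swap)) ∘ Equiv.prodComm ℕ ℕ := by
    intro n
    ext r
    rw [torusCoeff_swap, torusCoeff_swap]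
    rfl
  refine ⟨fun n ↦ ?_, h2.congr fun n ↦ ?_⟩
  · rw [key]
    exact (h1 n).comp_injective (Equiv.injective _)
  · have h3 := (Equiv.prodComm ℕ ℕ).tsum_eq fun r ↦
      torusCoeff f (natPair (q n).swap - natPair r) * torusCoeff g (natPair r - natPair (p n).swap)
    have h4 : natPair (q n).swap - natPair (p n).swap = (natPair (q n) - natPair (p n)).swap := rfl
    rw [key, h4, ← torusCoeff_swap, ← h3]
    rfl

/-! ### Vanishing of products of partial Fourier coefficients -/

/-- The Fourier coefficients of a function on `T²` in its second variable, as functions of the first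
variable. -/
noncomputable def partialCoeff (f : Circle × Circle → ℂ) (n : ℤ) (u : Circle) : ℂ :=
  circleCoeff (fun v ↦ f (u, v)) n

theorem integrable_mul_zpow {f : Circle × Circle → ℂ} (hf : Integrable f torusMeasure) (m n : ℤ) :
    Integrable (fun w ↦ f w * ((w.1 : ℂ) ^ m * (w.2 : ℂ) ^ n)) torusMeasure := by
  refine hf.mul_bdd (c := 1) ?_ (.of_forall fun w ↦ ?_)
  · exact (((continuous_circle_zpow m).comp continuous_fst).mul
      ((continuous_circle_zpow n).comp continuous_snd)).aestronglyMeasurable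
  · rw [norm_mul, norm_circle_zpow, norm_circle_zpow, one_mul]

theorem circleCoeff_partialCoeff {f : Circle × Circle → ℂ} (hf : Integrable f torusMeasure)
    (m n : ℤ) : circleCoeff (partialCoeff f n) m = torusCoeff f (m, n) := by
  rw [torusCoeff, torusMeasure, integral_prod _ (integrable_mul_zpow hf _ _), circleCoeff]
  refine integral_congr_ae (.of_forall fun u ↦ ?_)
  simp only [partialCoeff, circleCoeff, ← integral_mul_const]
  congr 1
  ext v
  ring

theorem norm_circleCoeff_le (φ : Circle → ℂ) (n : ℤ) :
    ‖circleCoeff φ n‖ ≤ ∫ u, ‖φ u‖ ∂circleMeasure := by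
  refine (norm_integral_le_integral_norm _).trans_eq ?_
  simp only [norm_mul, norm_circle_zpow, mul_one]

theorem memLp_partialCoeff {f : Circle × Circle → ℂ} (hf : MemLp f ∞ torusMeasure) (n : ℤ) :
    MemLp (partialCoeff f n) ∞ circleMeasure := by
  have hm : AEStronglyMeasurable (partialCoeff f n) circleMeasure := by
    have h : AEStronglyMeasurable (fun w ↦ f w * (w.2 : ℂ) ^ (-n)) torusMeasure :=
      hf.1.mul ((continuous_circle_zpow _).comp continuous_snd).aestronglyMeasurable
    exact h.integral_prod_right'
  have hb : ∀ᵐ w ∂torusMeasure, ‖f w‖ ≤ (eLpNormEssSup f torusMeasure).toReal := by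
    have h2 := hf.2
    rw [eLpNorm_exponent_top] at h2
    filter_upwards [ae_le_eLpNormEssSup (f := f) (μ := torusMeasure)] with w hw
    rw [← toReal_enorm]
    exact ENNReal.toReal_mono h2.ne hw
  refine memLp_top_of_bound hm (eLpNormEssSup f torusMeasure).toReal ?_
  filter_upwards [Measure.ae_ae_of_ae_prod hb] with u hu
  refine (norm_circleCoeff_le _ _).trans ((integral_mono_of_nonneg (.of_forall fun _ ↦
    norm_nonneg _) (integrable_const _) hu).trans_eq ?_)
  simp

/-- Splitting off the row of second index zero. -/
theorem tsum_prod_eq_tsum_zero_add {U : ℕ × ℕ → ℂ} (hU : Summable U) :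
    ∑' r, U r = ∑' b, U (b, 0) + ∑' r : ℕ × ℕ, U (r.1, r.2 + 1) := by
  have h0 : Summable fun b ↦ U (b, 0) := hU.comp_injective (i := fun b : ℕ ↦ (b, 0))
    fun a b h ↦ congrArg Prod.fst h
  have h1 : Summable fun r : ℕ × ℕ ↦ U (r.1, r.2 + 1) :=
    hU.comp_injective (i := fun r : ℕ × ℕ ↦ (r.1, r.2 + 1)) fun a b h ↦ by
      simpa [Prod.ext_iff] using h
  rw [hU.tsum_prod, h1.tsum_prod, ← h0.tsum_add h1.prod]
  refine tsum_congr fun b ↦ ?_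
  exact (hU.prod_factor b).tsum_eq_zero_add

/-- The sums of a summable family over the half-lines `[-n, ∞)` tend to the sum over `ℤ`. -/
theorem tendsto_tsum_int_sub {v : ℤ → ℂ} {S : ℂ} (hv : HasSum v S) :
    Tendsto (fun n : ℕ ↦ ∑' b : ℕ, v (b - n)) atTop (𝓝 S) := by
  have h1 : Summable fun b : ℕ ↦ v b := hv.summable.comp_injective Nat.cast_injective
  have h2 : Summable fun b : ℕ ↦ v (-(b + 1)) := hv.summable.comp_injective
    (i := fun b : ℕ ↦ -((b : ℤ) + 1)) fun a b h ↦ by simpa using h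
  have hS := hv.unique (HasSum.of_nat_of_neg_add_one h1.hasSum h2.hasSum)
  rw [hS, add_comm]
  refine (h2.hasSum.tendsto_sum_nat.add_const _).congr fun n ↦ ?_
  have h3 : Summable fun b : ℕ ↦ v (b - n) := hv.summable.comp_injective
    (i := fun b : ℕ ↦ (b : ℤ) - n) fun a b h ↦ by simpa using h
  rw [← h3.sum_add_tsum_nat_add n, ← Finset.sum_range_reflect]
  congr 1
  · refine Finset.sum_congr rfl fun b hb ↦ ?_
    have := Finset.mem_range.mp hb
    congr 1
    omega
  · simp

/-- Increasing both indices by one in the second variable adds to the matrix entry a single row of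
products, which is a tail of a Parseval sum. These tails exhaust the whole sum as both indices move
off to infinity in the first variable. The two natural numbers `s` and `t` let `t - s` be an
arbitrary integer. -/
theorem VanishingEntries.circleCoeff_partialCoeff_mul {f g : Circle × Circle → ℂ}
    (hf : MemLp f ∞ torusMeasure) (hg : MemLp g ∞ torusMeasure) (h : VanishingEntries f g)
    (j k s t : ℕ) :
    circleCoeff (fun u ↦ partialCoeff f (j + 1) u * partialCoeff g (-(k + 1)) u) (t - s) = 0 := by
  have hfi := hf.integrable le_top
  have hgi := hg.integrable le_top
  have hv := hasSum_circleCoeff_mul ((memLp_partialCoeff hf (j + 1)).mono_exponent le_top)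
    ((memLp_partialCoeff hg (-(k + 1))).mono_exponent le_top) s t
  simp only [circleCoeff_partialCoeff hfi, circleCoeff_partialCoeff hgi] at hv
  obtain ⟨-, h1⟩ := h (fun n ↦ (n + s, k)) (fun n ↦ (n + t, j)) fun a b hab ↦ by
    simpa using hab
  obtain ⟨h2, h3⟩ := h (fun n ↦ (n + s, k + 1)) (fun n ↦ (n + t, j + 1)) fun a b hab ↦ by
    simpa using hab
  have h4 := h3.sub h1
  rw [sub_zero] at h4
  refine tendsto_nhds_unique (tendsto_tsum_int_sub hv) (h4.congr fun n ↦ ?_)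
  rw [tsum_prod_eq_tsum_zero_add (h2 n)]
  have e1 : ∀ b : ℕ, torusCoeff f (natPair (n + t, j + 1) - natPair (b, 0)) *
      torusCoeff g (natPair (b, 0) - natPair (n + s, k + 1)) =
      torusCoeff f (t - (b - n), j + 1) * torusCoeff g (b - n - s, -(k + 1)) := fun b ↦ by
    congr 2 <;> ext <;> simp [natPair] <;> ring
  have e2 : ∀ r : ℕ × ℕ, torusCoeff f (natPair (n + t, j + 1) - natPair (r.1, r.2 + 1)) *
      torusCoeff g (natPair (r.1, r.2 + 1) - natPair (n + s, k + 1)) =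
      torusCoeff f (natPair (n + t, j) - natPair r) *
      torusCoeff g (natPair r - natPair (n + s, k)) := fun r ↦ by
    congr 2 <;> ext <;> simp [natPair]
  have e3 : natPair (n + t, j + 1) - natPair (n + s, k + 1) =
      natPair (n + t, j) - natPair (n + s, k) := by
    ext <;> simp [natPair]
  simp only [e1, e2, e3]
  ring

theorem VanishingEntries.ae_partialCoeff_mul_eq_zero {f g : Circle × Circle → ℂ}
    (hf : MemLp f ∞ torusMeasure) (hg : MemLp g ∞ torusMeasure) (h : VanishingEntries f g) :
    ∀ᵐ u ∂circleMeasure, ∀ j k : ℕ,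
      partialCoeff f (j + 1) u * partialCoeff g (-(k + 1)) u = 0 := by
  rw [ae_all_iff]
  intro j
  rw [ae_all_iff]
  intro k
  refine ae_eq_zero_of_circleCoeff_eq_zero
    (((memLp_partialCoeff hg _).mul' (memLp_partialCoeff hf _)).mono_exponent le_top) fun n ↦ ?_
  rw [show n = (n.toNat : ℤ) - ((-n).toNat : ℤ) by omega]
  exact h.circleCoeff_partialCoeff_mul hf hg j k _ _

/-! ### The Poisson integral and its Wirtinger derivatives -/

/-- The sum of the power series with coefficients `a`. -/
noncomputable def powerSum (a : ℕ → ℂ) (z : ℂ) : ℂ := ∑' n, a n * z ^ n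

theorem differentiableAt_powerSum {a : ℕ → ℂ} {C : ℝ} (ha : ∀ n, ‖a n‖ ≤ C) {z : ℂ}
    (hz : ‖z‖ < 1) : DifferentiableAt ℂ (powerSum a) z := by
  obtain ⟨r, hzr, hr⟩ := exists_between hz
  have hr0 : 0 ≤ r := (norm_nonneg z).trans hzr.le
  have h : DifferentiableOn ℂ (powerSum a) (Metric.ball 0 r) := by
    refine Complex.differentiableOn_tsum_of_summable_norm (u := fun n ↦ C * r ^ n)
      ((summable_geometric_of_lt_one hr0 hr).mul_left C) (fun n ↦ by fun_prop) Metric.isOpen_ball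
      fun n w hw ↦ ?_
    have hw' : ‖w‖ ≤ r := (mem_ball_zero_iff.mp hw).le
    rw [norm_mul, norm_pow]
    exact mul_le_mul (ha n) (pow_le_pow_left₀ (norm_nonneg _) hw' n) (by positivity)
      ((norm_nonneg _).trans (ha n))
  exact h.differentiableAt (Metric.isOpen_ball.mem_nhds (mem_ball_zero_iff.mpr hzr))

theorem powerSum_eq_of_succ_eq_zero {a : ℕ → ℂ} (ha : ∀ n, a (n + 1) = 0) :
    powerSum a = fun _ ↦ a 0 := by
  ext z
  rw [powerSum, tsum_eq_single 0]
  · simp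
  · intro n hn
    obtain ⟨m, rfl⟩ := Nat.exists_eq_succ_of_ne_zero hn
    simp [ha]

theorem norm_inv_one_sub_le {r : ℝ} (hr : r < 1) {x : ℂ} (hx : ‖x‖ = r) :
    ‖(1 - x)⁻¹‖ ≤ (1 - r)⁻¹ := by
  rw [norm_inv]
  have h := norm_sub_norm_le (1 : ℂ) x
  rw [norm_one, hx] at h
  exact inv_anti₀ (by linarith) h

theorem integrable_mul_inv_one_sub {φ h : Circle → ℂ} (hφ : Integrable φ circleMeasure)
    (hh : Continuous h) {r : ℝ} (hr : r < 1) (hhr : ∀ u, ‖h u‖ = r) :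
    Integrable (fun u ↦ φ u * (1 - h u)⁻¹) circleMeasure :=
  hφ.mul_bdd (c := (1 - r)⁻¹) (by
    have : Measurable h := hh.measurable
    exact Measurable.aestronglyMeasurable (by fun_prop))
    (.of_forall fun u ↦ norm_inv_one_sub_le hr (hhr u))

/-- Integration of a geometric series term by term against an integrable function. -/
theorem hasSum_integral_mul_pow {φ h : Circle → ℂ} (hφ : Integrable φ circleMeasure)
    (hh : Continuous h) {r : ℝ} (hr : r < 1) (hhr : ∀ u, ‖h u‖ = r) :
    HasSum (fun n : ℕ ↦ ∫ u, φ u * h u ^ n ∂circleMeasure)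
      (∫ u, φ u * (1 - h u)⁻¹ ∂circleMeasure) := by
  have hr0 : 0 ≤ r := (norm_nonneg _).trans_eq (hhr 1)
  have key : ∀ u, HasSum (fun n ↦ φ u * h u ^ n) (φ u * (1 - h u)⁻¹) := fun u ↦
    (hasSum_geometric_of_norm_lt_one ((hhr u).trans_lt hr)).mul_left _
  simp only [← fun u ↦ (key u).tsum_eq]
  refine hasSum_integral_of_summable_integral_norm (fun n ↦ ?_) ?_
  · refine hφ.mul_bdd (c := r ^ n) (hh.pow n).aestronglyMeasurable (.of_forall fun u ↦ ?_)
    rw [norm_pow, hhr]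
  · simp only [norm_mul, norm_pow, hhr, integral_mul_const]
    exact (summable_geometric_of_lt_one hr0 hr).mul_left _

theorem norm_mul_conj_coe_circle (z : ℂ) (u : Circle) : ‖z * conj (u : ℂ)‖ = ‖z‖ := by
  rw [norm_mul, RCLike.norm_conj, Circle.norm_coe, mul_one]

theorem norm_conj_mul_coe_circle (z : ℂ) (u : Circle) : ‖conj z * (u : ℂ)‖ = ‖z‖ := by
  rw [norm_mul, RCLike.norm_conj, Circle.norm_coe, mul_one]

theorem poissonKernel_eq {z : ℂ} (hz : ‖z‖ < 1) (u : Circle) :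
    (((1 - ‖z‖ ^ 2) / ‖1 - conj z * (u : ℂ)‖ ^ 2 : ℝ) : ℂ) =
      (1 - z * conj (u : ℂ))⁻¹ + (1 - conj z * (u : ℂ))⁻¹ - 1 := by
  have hne : ∀ x : ℂ, ‖x‖ = ‖z‖ → 1 - x ≠ 0 := fun x hx h ↦ by
    rw [← sub_eq_zero.mp h, norm_one] at hx
    linarith
  have h1 : 1 - conj z * (u : ℂ) ≠ 0 := hne _ (norm_conj_mul_coe_circle z u)
  have h2 : 1 - z * conj (u : ℂ) ≠ 0 := hne _ (norm_mul_conj_coe_circle z u)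
  have h3 : (‖1 - conj z * (u : ℂ)‖ ^ 2 : ℂ) = (1 - conj z * (u : ℂ)) * (1 - z * conj (u : ℂ)) := by
    rw [← Complex.mul_conj']
    simp
  have h4 : (‖z‖ ^ 2 : ℂ) = z * conj z := (Complex.mul_conj' z).symm
  have h5 : (u : ℂ) * conj (u : ℂ) = 1 := by
    rw [Complex.mul_conj', Circle.norm_coe]; simp
  push_cast
  rw [h3, h4, div_eq_iff (mul_ne_zero h1 h2)]
  field_simp
  linear_combination (z * conj z) * h5

/-- The Poisson integral is the sum of a holomorphic and an antiholomorphic power series, whose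
coefficients are the Fourier coefficients of nonnegative and nonpositive index. -/
theorem poissonExt_eq_powerSum {φ : Circle → ℂ} (hφ : Integrable φ circleMeasure) {z : ℂ}
    (hz : ‖z‖ < 1) :
    poissonExt φ z = powerSum (fun n ↦ circleCoeff φ n) z +
      powerSum (fun n ↦ circleCoeff φ (-n)) (conj z) - circleCoeff φ 0 := by
  have c1 : Continuous fun u : Circle ↦ z * conj (u : ℂ) := by fun_prop
  have c2 : Continuous fun u : Circle ↦ conj z * (u : ℂ) := by fun_prop
  have n1 := norm_mul_conj_coe_circle z
  have n2 := norm_conj_mul_coe_circle z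
  have e1 : powerSum (fun n ↦ circleCoeff φ n) z =
      ∫ u : Circle, φ u * (1 - z * conj (u : ℂ))⁻¹ ∂circleMeasure := by
    rw [← (hasSum_integral_mul_pow hφ c1 hz n1).tsum_eq, powerSum]
    refine tsum_congr fun n ↦ ?_
    rw [circleCoeff, ← integral_mul_const]
    congr 1
    ext u
    rw [mul_pow, ← Circle.coe_inv_eq_conj, Circle.coe_inv, inv_pow, zpow_neg, zpow_natCast]
    ring
  have e2 : powerSum (fun n ↦ circleCoeff φ (-n)) (conj z) =
      ∫ u : Circle, φ u * (1 - conj z * (u : ℂ))⁻¹ ∂circleMeasure := by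
    rw [← (hasSum_integral_mul_pow hφ c2 hz n2).tsum_eq, powerSum]
    refine tsum_congr fun n ↦ ?_
    rw [circleCoeff, ← integral_mul_const]
    congr 1
    ext u
    rw [mul_pow, neg_neg, zpow_natCast]
    ring
  have e3 : circleCoeff φ 0 = ∫ u, φ u ∂circleMeasure := by simp [circleCoeff]
  have i1 := integrable_mul_inv_one_sub hφ c1 hz n1
  have i2 := integrable_mul_inv_one_sub hφ c2 hz n2
  rw [e1, e2, e3, ← integral_add i1 i2]
  refine Eq.trans ?_ (integral_sub (i1.add i2) hφ)
  rw [poissonExt]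
  congr 1
  ext u
  rw [poissonKernel_eq hz]
  ring

/-- The real derivative of a Poisson integral, split into its complex linear and its complex
antilinear part. -/
theorem hasFDerivAt_poissonExt {φ : Circle → ℂ} (hφ : Integrable φ circleMeasure) {z : ℂ}
    (hz : ‖z‖ < 1) :
    HasFDerivAt (𝕜 := ℝ) (poissonExt φ)
      (deriv (powerSum fun n ↦ circleCoeff φ n) z • (1 : ℂ →L[ℝ] ℂ) +
        deriv (powerSum fun n ↦ circleCoeff φ (-n)) (conj z) • (Complex.conjCLE : ℂ →L[ℝ] ℂ)) z := by
  have hA := (differentiableAt_powerSum (a := fun n ↦ circleCoeff φ n)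
    (fun n ↦ norm_circleCoeff_le φ n) hz).hasDerivAt.complexToReal_fderiv
  have hB := (differentiableAt_powerSum (a := fun n ↦ circleCoeff φ (-n)) (z := conj z)
    (fun n ↦ norm_circleCoeff_le φ (-n)) (by simpa using hz)).hasDerivAt.complexToReal_fderiv
  have hC := HasFDerivAt.comp z hB (Complex.conjCLE : ℂ →L[ℝ] ℂ).hasFDerivAt
  have h := (hA.add hC).sub_const (circleCoeff φ 0)
  refine (h.congr_of_eventuallyEq ?_).congr_fderiv ?_
  · filter_upwards [Metric.isOpen_ball.mem_nhds (mem_ball_zero_iff.mpr hz)] with w hw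
    exact poissonExt_eq_powerSum hφ (mem_ball_zero_iff.mp hw)
  · ext; simp

theorem dz_poissonExt {φ : Circle → ℂ} (hφ : Integrable φ circleMeasure) {z : ℂ} (hz : ‖z‖ < 1) :
    dz (poissonExt φ) z = deriv (powerSum fun n ↦ circleCoeff φ n) z := by
  rw [dz, (hasFDerivAt_poissonExt hφ hz).fderiv]
  simp only [add_apply, smul_apply, one_apply_eq_self, ContinuousLinearEquiv.coe_coe,
    Complex.conjCLE_apply, map_one, Complex.conj_I, smul_eq_mul]
  linear_combination (-1/2) * (deriv (powerSum fun n ↦ circleCoeff φ n) z -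
    deriv (powerSum fun n ↦ circleCoeff φ (-n)) (conj z)) * Complex.I_sq

theorem dzbar_poissonExt {φ : Circle → ℂ} (hφ : Integrable φ circleMeasure) {z : ℂ}
    (hz : ‖z‖ < 1) :
    dzbar (poissonExt φ) z = deriv (powerSum fun n ↦ circleCoeff φ (-n)) (conj z) := by
  rw [dzbar, (hasFDerivAt_poissonExt hφ hz).fderiv]
  simp only [add_apply, smul_apply, one_apply_eq_self, ContinuousLinearEquiv.coe_coe,
    Complex.conjCLE_apply, map_one, Complex.conj_I, smul_eq_mul]
  linear_combination (1/2) * (deriv (powerSum fun n ↦ circleCoeff φ n) z -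
    deriv (powerSum fun n ↦ circleCoeff φ (-n)) (conj z)) * Complex.I_sq

theorem dz_mul_dzbar_poissonExt_eq_zero {φ ψ : Circle → ℂ} (hφ : Integrable φ circleMeasure)
    (hψ : Integrable ψ circleMeasure)
    (h : ∀ j k : ℕ, circleCoeff φ (j + 1) * circleCoeff ψ (-(k + 1)) = 0) {z : ℂ}
    (hz : ‖z‖ < 1) : dz (poissonExt φ) z * dzbar (poissonExt ψ) z = 0 := by
  rw [dz_poissonExt hφ hz, dzbar_poissonExt hψ hz]
  by_cases hj : ∀ j : ℕ, circleCoeff φ (j + 1) = 0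
  · rw [powerSum_eq_of_succ_eq_zero (a := fun n ↦ circleCoeff φ n) fun n ↦ by
      simpa using hj n, deriv_const, zero_mul]
  · obtain ⟨j, hj⟩ := not_forall.mp hj
    rw [powerSum_eq_of_succ_eq_zero (a := fun n ↦ circleCoeff ψ (-n)) fun n ↦ by
      simpa using (mul_eq_zero.mp (h j n)).resolve_left hj, deriv_const, mul_zero]

/-- The conclusion for the slices in the second variable. -/
theorem VanishingEntries.ae_dz_mul_dzbar {f g : Circle × Circle → ℂ}
    (hf : MemLp f ∞ torusMeasure) (hg : MemLp g ∞ torusMeasure) (h : VanishingEntries f g) :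
    ∀ᵐ u ∂circleMeasure, ∀ z ∈ Metric.ball (0 : ℂ) 1,
      DifferentiableAt ℝ (poissonExt fun v ↦ f (u, v)) z ∧
      DifferentiableAt ℝ (poissonExt fun v ↦ g (u, v)) z ∧
      dz (poissonExt fun v ↦ f (u, v)) z * dzbar (poissonExt fun v ↦ g (u, v)) z = 0 := by
  filter_upwards [h.ae_partialCoeff_mul_eq_zero hf hg, (hf.integrable le_top).prod_right_ae,
    (hg.integrable le_top).prod_right_ae] with u hu hfu hgu z hz
  have hz' := mem_ball_zero_iff.mp hz
  exact ⟨(hasFDerivAt_poissonExt hfu hz').differentiableAt,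
    (hasFDerivAt_poissonExt hgu hz').differentiableAt,
    dz_mul_dzbar_poissonExt_eq_zero hfu hgu hu hz'⟩

end Bidisc

theorem theorem2 (f g : Circle × Circle → ℂ)
    (hf : MemLp f ∞ Bidisc.torusMeasure) (hg : MemLp g ∞ Bidisc.torusMeasure)
    (hcompact : IsCompactOperator
      (Bidisc.toeplitz hf ∘L Bidisc.toeplitz hg -
        Bidisc.toeplitz (f := fun w ↦ f w * g w) (hg.mul' hf))) :
    (∀ᵐ z₂ : Circle ∂Bidisc.circleMeasure, ∀ z₁ ∈ Metric.ball (0 : ℂ) 1,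
      DifferentiableAt ℝ (Bidisc.poissonExt fun u ↦ f (u, z₂)) z₁ ∧
      DifferentiableAt ℝ (Bidisc.poissonExt fun u ↦ g (u, z₂)) z₁ ∧
      Bidisc.dz (Bidisc.poissonExt fun u ↦ f (u, z₂)) z₁ *
        Bidisc.dzbar (Bidisc.poissonExt fun u ↦ g (u, z₂)) z₁ = 0) ∧
    (∀ᵐ z₁ : Circle ∂Bidisc.circleMeasure, ∀ z₂ ∈ Metric.ball (0 : ℂ) 1,
      DifferentiableAt ℝ (Bidisc.poissonExt fun u ↦ f (z₁, u)) z₂ ∧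
      DifferentiableAt ℝ (Bidisc.poissonExt fun u ↦ g (z₁, u)) z₂ ∧
      Bidisc.dz (Bidisc.poissonExt fun u ↦ f (z₁, u)) z₂ *
        Bidisc.dzbar (Bidisc.poissonExt fun u ↦ g (z₁, u)) z₂ = 0) := by
  have h := Bidisc.vanishingEntries_of_isCompactOperator hf hg hcompact
  have hswap : MeasurePreserving Prod.swap Bidisc.torusMeasure Bidisc.torusMeasure :=
    Measure.measurePreserving_swap
  -- Exchanging the variables turns the slices in the first variable into those in the second.
  exact ⟨h.swap.ae_dz_mul_dzbar (hf.comp_measurePreserving hswap)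
    (hg.comp_measurePreserving hswap), h.ae_dz_mul_dzbar hf hg⟩
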